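/- Let $n\ge 0$ be an integer, let $\tau>0$, and let $\mathcal C_\tau$ be the Banach space of continuous functions $\phi:[-\tau,0]\to\mathbb R^n$ with $\|\phi\|=\sup_\theta\|\phi(\theta)\|_2$. Let $f:\mathbb R^n\times\mathbb R^n\to\mathbb R^n$ be continuous and consider $$\dot x(t)=f(x(t),x(t-\tau)),\qquad t\ge 0,$$ (at $t=0$ the derivative is the right derivative). Assume, so that the solution map is defined, that every initial condition $\phi\in\mathcal C_\tau$ has a unique continuous solution $G\phi:[-\tau,\infty)\to\mathbb R^n$ with $(G\phi)(\theta)=\phi(\theta)$ on $[-\tau,0]$, and put $\Gamma(\phi,s)=(G\phi)(s+\cdot)|_{[-\tau,0]}$ for $s\ge 0$. Write $\Sigma_s$ for the finite sums of squares of real polynomials and, for an integer $k\ge0$, write $Z_k[y]$ for the column vector of all monomials of (total) degree at most $k$ in the variables $y$. For an integer $d\ge 0$ define the following sets of real polynomials of degree at most $d$. * $\Xi_1^d$: the polynomials $p(x_1,x_2,\theta)$ for which there are $\alpha>0$ and a polynomial $t(x_1,\theta)$ of degree at most $d$ with $p-t-\alpha\|x_1\|^2\in\Sigma_s$ and $\int_{-\tau}^0t(x_1,\theta)\,d\theta=0$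 for all $x_1$. * $\Xi_2^d$: the polynomials $p(x_1,x_2,\theta,\omega)$ of the form $Z_e[x_1]^TR(\theta,\omega)Z_e[x_2]$ with $e=\lfloor d/2\rfloor$ and $R(\theta,\omega)=(I\otimes Z_e[\theta])^TQ\,(I\otimes Z_e[\omega])$ for some symmetric positive semidefinite matrix $Q$, where $I$ is the identity matrix of size $\binom{n+e}{e}$. * $\Xi_3^d$: the polynomials $p(x_1,x_2,x_3,\theta)$ for which there are $\alpha>0$ and a polynomial $t(x_1,x_2,\theta)$ of degree at most $d$ with $p-t-\alpha\|x_1\|^2\in\Sigma_s$ and $\int_{-\tau}^0t(x_1,x_2,\theta)\,d\theta=0$ for all $x_1,x_2$. (Here $x_1,x_2,x_3\in\mathbb R^n$ and $\theta,\omega\in\mathbb R$.) Suppose that for some integer $d\ge0$ there are $g\in\Xi_1^d$, $h,\hat h\in\Xi_2^d$ and a polynomial $\hat g$ with $-\hat g\in\Xi_3^d$ such that for all $\phi\in\mathcal C_\tau$ and $\theta,\omega\in[-\tau,0]$ $$\begin{aligned}\hat g(\phi(0),\phi(-\tau),\phi(\theta),\theta)={}&g(\phi(0),\phi(0),0)-g(\phi(0),\phi(-\tau),-\tau)\\&+\tau\,\nabla_{x_1}g(\phi(0),\phi(\theta),\theta)^Tf(\phi(0),\phi(-\tau))-\tau\,\tfrac{\partial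 g}{\partial\theta}(\phi(0),\phi(\theta),\theta)\\&+\tau h(\phi(0),\phi(\theta),0,\theta)-\tau h(\phi(-\tau),\phi(\theta),-\tau,\theta)\\&+\tau h(\phi(\theta),\phi(0),\theta,0)-\tau h(\phi(\theta),\phi(-\tau),\theta,-\tau),\\ \hat h(\phi(\theta),\phi(\omega),\theta,\omega)={}&\tfrac{\partial h}{\partial\theta}(\phi(\theta),\phi(\omega),\theta,\omega)+\tfrac{\partial h}{\partial\omega}(\phi(\theta),\phi(\omega),\theta,\omega),\end{aligned}$$ where $\nabla_{x_1}$ is the gradient in the first vector argument, and $\partial/\partial\theta$, $\partial/\partial\omega$ are the partial derivatives in the explicit scalar arguments. Then the system is globally asymptotically stable: $f(0,0)=0$; for every $\phi\in\mathcal C_\tau$ the solution $G\phi$ is bounded and $(G\phi)(t)\to0$ as $t\to\infty$; and for every $\varepsilon>0$ there is $\delta>0$ such that $\|\phi\|<\delta$ implies $\|(G\phi)(t)\|_2<\varepsilon$ for all $t\ge-\tau$. Moreover the functional $$V(\phi)=\int_{-\tau}^0g(\phi(0),\phi(\theta),\theta)\,d\theta+\int_{-\tau}^0\!\int_{-\tau}^0h(\phi(\theta),\phi(\omega),\theta,\omega)\,d\theta\,d\omega$$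 satisfies, for some $\alpha>0$ and all $\phi\in\mathcal C_\tau$, $$V(\phi)\ge\alpha\|\phi(0)\|_2^2,\qquad \limsup_{s\to0^+}\frac{V(\Gamma(\phi,s))-V(\phi)}{s}\le-\alpha\|\phi(0)\|_2^2 .$$ -/

import Mathlib

open Set Filter Topology MvPolynomial
open scoped Matrix

noncomputable section

namespace TimeDelay

/-! ### Functional differential equations -/

/-- `ℝⁿ` with the Euclidean norm. -/
abbrev Vec (n : ℕ) : Type := EuclideanSpace ℝ (Fin n)

/-- The Banach space `𝒞_τ` of continuous functions `[-τ, 0] → ℝⁿ` with the supremum norm. -/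
abbrev State (n : ℕ) (τ : ℝ) : Type := C(Icc (-τ) (0 : ℝ), Vec n)

/-- The space `𝒞([-τ, ∞))` of continuous functions `[-τ, ∞) → ℝⁿ`. -/
abbrev Traj (n : ℕ) (τ : ℝ) : Type := C(Ici (-τ), Vec n)

/-- The endpoint `0` of `[-τ, 0]`. -/
def now {τ : ℝ} (hτ : 0 < τ) : Icc (-τ) (0 : ℝ) := ⟨0, by linarith, le_rfl⟩

/-- The endpoint `-τ` of `[-τ, 0]`. -/
def past {τ : ℝ} (hτ : 0 < τ) : Icc (-τ) (0 : ℝ) := ⟨-τ, le_rfl, by linarith⟩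

variable {n : ℕ} {τ : ℝ}

/-- The state `x_t ∈ 𝒞_τ`, `x_t(θ) = x(t + θ)`, of a trajectory `x` at a time `t`. It is used
for `t ≥ 0` only, where `t + θ ≥ -τ`, so that the constant extension of `x` to the left of `-τ`
plays no role. -/
def stateAt (x : Traj n τ) (t : ℝ) : State n τ where
  toFun θ := IciExtend x (t + θ)
  continuous_toFun := by
    have h : Continuous (IciExtend (x : Ici (-τ) → Vec n)) :=
      x.continuous.comp ((continuous_const.max continuous_id).subtype_mk _)
    exact h.comp (continuous_const.add continuous_subtype_val)

/-- `x` is a solution on `[-τ, ∞)` of `ẋ(t) = F(x_t)` with initial condition `φ`. At `t = 0` the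
derivative is the right derivative, at `t > 0` it is the ordinary one. -/
def IsSolution (F : State n τ → Vec n) (φ : State n τ) (x : Traj n τ) : Prop :=
  (∀ θ : Icc (-τ) (0 : ℝ), x ⟨θ, θ.2.1⟩ = φ θ) ∧
    ∀ t : ℝ, 0 ≤ t → HasDerivWithinAt (IciExtend x) (F (stateAt x t)) (Ici 0) t

/-- The solution map of `F` is defined: every initial condition has a unique solution on
`[-τ, ∞)`. -/
def HasSolutionMap (F : State n τ → Vec n) : Prop :=
  ∀ φ : State n τ, ∃! x : Traj n τ, IsSolution F φ x

/-- The solution map `G_F : 𝒞_τ → 𝒞([-τ, ∞))`. -/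
def solutionMap {F : State n τ → Vec n} (hF : HasSolutionMap F) (φ : State n τ) : Traj n τ :=
  (hF φ).choose

/-- The flow map `Γ_F(φ, h) = (G_F φ)_h`. -/
def flowMap {F : State n τ → Vec n} (hF : HasSolutionMap F) (φ : State n τ) (h : ℝ) :
    State n τ :=
  stateAt (solutionMap hF φ) h

/-- Stability of the solution map on `X`: the origin is an equilibrium, `G_F φ` is bounded for
every `φ ∈ X`, and `G_F` is continuous at `0` for the supremum norms. -/
def IsStableOn {F : State n τ → Vec n} (hF : HasSolutionMap F) (X : Set (State n τ)) : Prop :=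
  F 0 = 0 ∧
  (∀ φ ∈ X, ∃ b : ℝ, ∀ t : Ici (-τ), ‖solutionMap hF φ t‖ ≤ b) ∧
  (∀ ε : ℝ, 0 < ε → ∃ δ : ℝ, 0 < δ ∧
    ∀ φ : State n τ, ‖φ‖ < δ → ∀ t : Ici (-τ), ‖solutionMap hF φ t‖ < ε)

/-- Asymptotic stability of the solution map on `X`. -/
def IsAsymptoticallyStableOn {F : State n τ → Vec n} (hF : HasSolutionMap F)
    (X : Set (State n τ)) : Prop :=
  IsStableOn hF X ∧ ∀ φ ∈ X, Tendsto (fun t : Ici (-τ) => solutionMap hF φ t) atTop (𝓝 0)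

/-- Global asymptotic stability of the solution map. -/
def IsGloballyAsymptoticallyStable {F : State n τ → Vec n} (hF : HasSolutionMap F) : Prop :=
  IsAsymptoticallyStableOn hF univ

/-- The upper Lie derivative `limsup_{h → 0⁺} (V(Γ_F(φ, h)) - V(φ)) / h`. -/
def upperLieDeriv {F : State n τ → Vec n} (hF : HasSolutionMap F) (V : State n τ → ℝ)
    (φ : State n τ) : EReal :=
  limsup (fun h : ℝ => (((V (flowMap hF φ h) - V φ) / h : ℝ) : EReal)) (𝓝[>] 0)

/-- The functional of the single-delay system `ẋ(t) = f(x(t), x(t - τ))`. -/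
def singleDelay (hτ : 0 < τ) (f : Vec n → Vec n → Vec n) : State n τ → Vec n :=
  fun φ => f (φ (now hτ)) (φ (past hτ))

/-! ### Polynomials in several vector variables and several scalar variables -/

/-- Names of the scalar variables: the coordinates of `k` vectors of `ℝⁿ`, and `m` further
scalars. -/
abbrev Vars (n k m : ℕ) : Type := (Fin k × Fin n) ⊕ Fin m

/-- Real polynomials in `k` vectors `x₁, …, x_k` of `ℝⁿ` and `m` scalars. -/
abbrev VPoly (n k m : ℕ) : Type := MvPolynomial (Vars n k m) ℝ

/-- The value of a polynomial at given vectors and scalars. -/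
def value {k m : ℕ} (p : VPoly n k m) (x : Fin k → Vec n) (s : Fin m → ℝ) : ℝ :=
  eval (Sum.elim (fun ji => x ji.1 ji.2) s) p

/-- The partial derivative in the `i`-th coordinate of the `j`-th vector. -/
def dVec {k m : ℕ} (j : Fin k) (i : Fin n) (p : VPoly n k m) : VPoly n k m :=
  pderiv (Sum.inl (j, i)) p

/-- The partial derivative in the `j`-th scalar. -/
def dScal {k m : ℕ} (j : Fin m) (p : VPoly n k m) : VPoly n k m :=
  pderiv (Sum.inr j) p

/-- A polynomial in `x₁, …, x_k` seen as one in `x₁, …, x_{k+1}` that does not involve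
`x_{k+1}`. -/
def addVec {k m : ℕ} (t : VPoly n k m) : VPoly n (k + 1) m :=
  rename (Sum.map (Prod.map Fin.castSucc id) id) t

/-- The polynomial `‖x₁‖²`. -/
def normSqFst {k m : ℕ} : VPoly n (k + 1) m :=
  ∑ i : Fin n, X (Sum.inl (0, i)) ^ 2

/-- The class `Ξ₁^d`: polynomials `p(x₁, x₂, θ)` of degree at most `d` such that
`p(x₁, x₂, θ) - t(x₁, θ) - α‖x₁‖²` is a sum of squares of polynomials, for some `α > 0` and some
polynomial `t` of degree at most `d` with `∫_{-τ}^0 t(x₁, θ) dθ = 0` for all `x₁`. -/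
def Xi₁ (n : ℕ) (τ : ℝ) (d : ℕ) : Set (VPoly n 2 1) :=
  {p | p.totalDegree ≤ d ∧ ∃ (t : VPoly n 1 1) (α : ℝ), t.totalDegree ≤ d ∧ 0 < α ∧
    IsSumSq (p - addVec t - C α * normSqFst) ∧
    ∀ x₁ : Vec n, ∫ θ in (-τ)..0, value t ![x₁] ![θ] = 0}

/-- The class `Ξ₃^d`: polynomials `p(x₁, x₂, x₃, θ)` of degree at most `d` such that
`p(x₁, x₂, x₃, θ) - t(x₁, x₂, θ) - α‖x₁‖²` is a sum of squares of polynomials, for some `α > 0`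
and some polynomial `t` of degree at most `d` with `∫_{-τ}^0 t(x₁, x₂, θ) dθ = 0` for all
`x₁, x₂`. -/
def Xi₃ (n : ℕ) (τ : ℝ) (d : ℕ) : Set (VPoly n 3 1) :=
  {p | p.totalDegree ≤ d ∧ ∃ (t : VPoly n 2 1) (α : ℝ), t.totalDegree ≤ d ∧ 0 < α ∧
    IsSumSq (p - addVec t - C α * normSqFst) ∧
    ∀ x₁ x₂ : Vec n, ∫ θ in (-τ)..0, value t ![x₁, x₂] ![θ] = 0}

/-- Exponents of the monomials of degree at most `d` in `n` variables; there are
`(n + d).choose d` of them. -/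
abbrev MonExp (n d : ℕ) : Type := {e : Fin n → Fin (d + 1) // ∑ i, (e i : ℕ) ≤ d}

/-- The vector `Z_d(x)` of all monomials of degree at most `d` in the coordinates of `x`. -/
def monomials (d : ℕ) (x : Vec n) : MonExp n d → ℝ :=
  fun e => ∏ i, x i ^ (e.1 i : ℕ)

/-- The matrix `I ⊗ Z_d(θ)`, where `Z_d(θ) = (1, θ, …, θ^d)` is a column. -/
def blockMonomials (ι : Type) [DecidableEq ι] (d : ℕ) (θ : ℝ) :
    Matrix (ι × Fin (d + 1)) ι ℝ :=
  Matrix.of fun a b => if a.1 = b then θ ^ (a.2 : ℕ) else 0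

/-- The class `G₂^{2d}` of matrix kernels `R(θ, ω) = (I ⊗ Z_d(θ))ᵀ Q (I ⊗ Z_d(ω))` with `Q`
positive semidefinite: the kernels of the positive finite-rank integral operators whose
eigenvectors are polynomial of degree at most `d`. The parameter of `G₂` here is `d`. -/
def G₂ (ι : Type) [Fintype ι] [DecidableEq ι] (d : ℕ) : Set (ℝ → ℝ → Matrix ι ι ℝ) :=
  {R | ∃ Q : Matrix (ι × Fin (d + 1)) (ι × Fin (d + 1)) ℝ, Q.PosSemidef ∧
    ∀ θ ω : ℝ, R θ ω = (blockMonomials ι d θ)ᵀ * Q * blockMonomials ι d ω}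

/-- The class `Ξ₂^d`: polynomials `p(x₁, x₂, θ, ω)` of degree at most `d` of the form
`Z_e(x₁)ᵀ R(θ, ω) Z_e(x₂)` with `R ∈ G₂^{2e}`, where `e = ⌊d/2⌋`. -/
def Xi₂ (n d : ℕ) : Set (VPoly n 2 2) :=
  {p | p.totalDegree ≤ d ∧ ∃ R ∈ G₂ (MonExp n (d / 2)) (d / 2),
    ∀ (x₁ x₂ : Vec n) (θ ω : ℝ),
      value p ![x₁, x₂] ![θ, ω] =
        monomials (d / 2) x₁ ⬝ᵥ (R θ ω *ᵥ monomials (d / 2) x₂)}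

/-- The functional
`V(φ) = ∫_{-τ}^0 g(φ(0), φ(θ), θ) dθ + ∫_{-τ}^0 ∫_{-τ}^0 h(φ(θ), φ(ω), θ, ω) dθ dω`. Only the
values of the constant extension of `φ` on `[-τ, 0]` enter. -/
def lyapunov (hτ : 0 < τ) (g : VPoly n 2 1) (h : VPoly n 2 2) (φ : State n τ) : ℝ :=
  let φ' : ℝ → Vec n := IccExtend (neg_nonpos.mpr hτ.le) φ
  (∫ θ in (-τ)..0, value g ![φ (now hτ), φ' θ] ![θ]) +
    ∫ ω in (-τ)..0, ∫ θ in (-τ)..0, value h ![φ' θ, φ' ω] ![θ, ω]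

end TimeDelay

end

open TimeDelay

namespace TimeDelay

/-! ### Evaluation of polynomials in vector and scalar variables. -/

section Value

variable {n k m : ℕ}

/-! The functional is a Lyapunov functional with quadratic lower bound and quadratic decay in the
present value only. In `Xi₁` and `Xi₃` the slack `t` integrates to zero, so the sum of squares
leaves `τ α ‖x₁‖²` after integration. A kernel in `Xi₂` has double integral `vᵀ Q v ≥ 0`, where `v`
is the integral of the monomial vector.

Along a solution `γ`, the derivative of `V` consists of boundary terms, the term of `f`, and
explicit derivatives. The two identities for `gHat` and `hHat` say that it equals `(1/τ) ∫ gHat - ∬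
hHat`, which the cone memberships bound. An initial state is only continuous, so `γ(t + θ)` cannot
be differentiated under the integral; `hasDerivWithinAt_integral_value` and
`hasDerivAt_doubleIntegral_value` instead use induction on the polynomial with arbitrary continuous
weights in `t + θ`, which reduces everything to moving endpoints of integration.

Since `V 0` need not vanish, stability takes a detour. Monotonicity of `V` bounds each solution,
hence makes it Lipschitz, and a Barbalat argument (`decay_of_le_norm`, `tendsto_zero_of_decay`)
gives convergence to zero. The states then converge to the zero state, so continuity of `V` shows
that `V 0` is its minimum. An excursion to norm `ε` costs a fixed amount of `V`, which is
unavailable when `V φ` is close to `V 0`. The equilibrium property follows because a convergent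
curve whose derivative converges has limiting derivative zero. -/

@[simp] lemma value_add (p q : VPoly n k m) (x : Fin k → Vec n) (s : Fin m → ℝ) :
    value (p + q) x s = value p x s + value q x s := by simp [value]

@[simp] lemma value_sub (p q : VPoly n k m) (x : Fin k → Vec n) (s : Fin m → ℝ) :
    value (p - q) x s = value p x s - value q x s := by simp [value]

@[simp] lemma value_neg (p : VPoly n k m) (x : Fin k → Vec n) (s : Fin m → ℝ) :
    value (-p) x s = -value p x s := by simp [value]

@[simp] lemma value_zero (x : Fin k → Vec n) (s : Fin m → ℝ) :
    value (0 : VPoly n k m) x s = 0 := by simp [value]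

@[simp] lemma value_mul (p q : VPoly n k m) (x : Fin k → Vec n) (s : Fin m → ℝ) :
    value (p * q) x s = value p x s * value q x s := by simp [value]

@[simp] lemma value_sum {ι : Type*} (S : Finset ι) (p : ι → VPoly n k m) (x : Fin k → Vec n)
    (s : Fin m → ℝ) : value (∑ i ∈ S, p i) x s = ∑ i ∈ S, value (p i) x s := by simp [value]

@[simp] lemma value_smul (c : ℝ) (p : VPoly n k m) (x : Fin k → Vec n) (s : Fin m → ℝ) :
    value (c • p) x s = c * value p x s := by simp [value, smul_eval]

@[simp] lemma value_C (c : ℝ) (x : Fin k → Vec n) (s : Fin m → ℝ) :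
    value (C c : VPoly n k m) x s = c := by simp [value]

@[simp] lemma value_X_inl (ji : Fin k × Fin n) (x : Fin k → Vec n) (s : Fin m → ℝ) :
    value (X (Sum.inl ji) : VPoly n k m) x s = x ji.1 ji.2 := by simp [value]

@[simp] lemma value_X_inr (j : Fin m) (x : Fin k → Vec n) (s : Fin m → ℝ) :
    value (X (Sum.inr j) : VPoly n k m) x s = s j := by simp [value]

lemma value_addVec (t : VPoly n k m) (x : Fin (k + 1) → Vec n) (s : Fin m → ℝ) :
    value (addVec t) x s = value t (fun j => x j.castSucc) s := by
  simp only [value, addVec, eval_rename]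
  congr 2
  ext v
  rcases v with v | v <;> rfl

@[simp] lemma value_normSqFst (x : Fin (k + 1) → Vec n) (s : Fin m → ℝ) :
    value (normSqFst : VPoly n (k + 1) m) x s = ‖x 0‖ ^ 2 := by
  simp [normSqFst, value, EuclideanSpace.norm_sq_eq]

lemma value_nonneg_of_isSumSq {p : VPoly n k m} (hp : IsSumSq p) (x : Fin k → Vec n)
    (s : Fin m → ℝ) : 0 ≤ value p x s := by
  induction hp with
  | zero => simp
  | sq_add a _ ih => simpa using add_nonneg (mul_self_nonneg _) ih

@[fun_prop] lemma continuous_value {Y : Type*} [TopologicalSpace Y] (p : VPoly n k m)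
    {x : Y → Fin k → Vec n} {s : Y → Fin m → ℝ} (hx : Continuous x) (hs : Continuous s) :
    Continuous fun y => value p (x y) (s y) := by
  refine (continuous_eval p).comp (continuous_pi fun v => ?_)
  rcases v with v | v
  · simp only [Sum.elim_inl]; fun_prop
  · simp only [Sum.elim_inr]; fun_prop

end Value

/-! ### Differentiating the functional along merely continuous histories. -/

section Leibniz

variable {n : ℕ} {τ : ℝ}

/-- The substitution `s = t + θ` moves `t` into the endpoints, so `w` only has to be continuous. -/
lemma hasDerivAt_integral_shift {w : ℝ → ℝ} (hw : Continuous w) (t : ℝ) :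
    HasDerivAt (fun t => ∫ θ in (-τ)..0, w (t + θ)) (w t - w (t - τ)) t := by
  have h (t : ℝ) : ∫ θ in (-τ)..0, w (t + θ) =
      (∫ s in (0 : ℝ)..t, w s) - ∫ s in (0 : ℝ)..(t - τ), w s := by
    rw [intervalIntegral.integral_comp_add_left, intervalIntegral.integral_interval_sub_left
      (hw.intervalIntegrable _ _) (hw.intervalIntegrable _ _), add_zero, sub_eq_add_neg]
  simp only [h]
  have h1 := hw.integral_hasStrictDerivAt 0 t |>.hasDerivAt
  have h2 := (hw.integral_hasStrictDerivAt 0 (t - τ)).hasDerivAt.comp_sub_const t τ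
  exact h1.sub h2

lemma derivation_sum_apply {R A M ι : Type*} [CommSemiring R] [CommSemiring A] [Algebra R A]
    [AddCommMonoid M] [Module A M] [Module R M] (S : Finset ι) (D : ι → Derivation R A M) (a : A) :
    (∑ i ∈ S, D i) a = ∑ i ∈ S, D i a := by
  classical
  induction S using Finset.induction_on with
  | empty => simp
  | insert i S hi ih => simp [Finset.sum_insert hi, ih]

/-- The derivation giving the derivative of `p(x₁, X(t + θ), θ)` along `ẋ₁ = y` at constant
`t + θ`. -/
noncomputable def flowDerivation (y : Vec n) : Derivation ℝ (VPoly n 2 1) (VPoly n 2 1) :=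
  mkDerivation ℝ (Sum.elim (fun ji => if ji.1 = 0 then C (y ji.2) else 0) fun _ => -1)

/-- Derivations agreeing on the variables coincide. The sign of the scalar term comes from `θ = s -
t` at constant `s = t + θ`. -/
lemma value_flowDerivation (y : Vec n) (p : VPoly n 2 1) (x : Fin 2 → Vec n) (s : Fin 1 → ℝ) :
    value (flowDerivation y p) x s =
      ∑ i, value (dVec 0 i p) x s * y i - value (dScal 0 p) x s := by
  have h : flowDerivation y =
      ∑ i, y i • pderiv (R := ℝ) (Sum.inl (0, i) : Vars n 2 1) - pderiv (Sum.inr 0) := by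
    refine MvPolynomial.derivation_ext fun v => ?_
    rcases v with ⟨j, i⟩ | v
    · fin_cases j <;>
        simp [flowDerivation, mkDerivation_X, pderiv_X, Pi.single_apply, derivation_sum_apply,
          smul_eq_C_mul]
    · simp [flowDerivation, mkDerivation_X, pderiv_X, Subsingleton.elim v 0, derivation_sum_apply]
  rw [h]
  simp [dVec, dScal, mul_comm, derivation_sum_apply]

lemma hasDerivWithinAt_of_eq {u v : ℝ → ℝ} {u' v' t : ℝ} {S : Set ℝ}
    (h : HasDerivWithinAt u u' S t) (huv : ∀ t, v t = u t) (h' : v' = u') :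
    HasDerivWithinAt v v' S t := by
  rw [h', funext huv]
  exact h

/-- The statement is quantified over all weights `w` so that the induction on `p` can absorb factors
depending on `t + θ` alone into `w`. -/
lemma hasDerivWithinAt_integral_value {γ : ℝ → Vec n} (hγ : Continuous γ) {S : Set ℝ} {t : ℝ}
    {y : Vec n} (hγt : HasDerivWithinAt γ y S t) (p : VPoly n 2 1) :
    ∀ w : ℝ → ℝ, Continuous w → HasDerivWithinAt
      (fun t => ∫ θ in (-τ)..0, w (t + θ) * value p ![γ t, γ (t + θ)] ![θ])
      (w t * value p ![γ t, γ t] ![0] - w (t - τ) * value p ![γ t, γ (t - τ)] ![-τ]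
        + ∫ θ in (-τ)..0, w (t + θ) * value (flowDerivation y p) ![γ t, γ (t + θ)] ![θ]) S t := by
  have hc (w : ℝ → ℝ) (hw : Continuous w) (q : VPoly n 2 1) (t : ℝ) :
      IntervalIntegrable (fun θ => w (t + θ) * value q ![γ t, γ (t + θ)] ![θ])
        MeasureTheory.volume (-τ) 0 := by
    apply Continuous.intervalIntegrable
    fun_prop
  induction p using MvPolynomial.induction_on with
  | C a =>
    intro w hw
    have h := (hasDerivAt_integral_shift (τ := τ) hw t).hasDerivWithinAt (s := S) |>.mul_const a
    simpa [flowDerivation, sub_mul] using h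
  | add p q hp hq =>
    intro w hw
    refine hasDerivWithinAt_of_eq ((hp w hw).add (hq w hw)) (fun t => ?_) ?_
    · simp only [value_add, mul_add, Pi.add_apply]
      rw [intervalIntegral.integral_add (hc w hw p t) (hc w hw q t)]
    · simp only [map_add, value_add, mul_add]
      rw [intervalIntegral.integral_add (hc w hw _ t) (hc w hw _ t)]
      ring
  | mul_X p v hp =>
    intro w hw
    rcases v with ⟨j, i⟩ | v
    · by_cases hj : j = 0
      · subst hj
        -- A factor from `x₁` leaves the integral, and the product rule applies.
        have hγi : HasDerivWithinAt (fun t => γ t i) (y i) S t :=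
          (EuclideanSpace.proj (𝕜 := ℝ) i).hasFDerivAt.comp_hasDerivWithinAt t hγt
        refine hasDerivWithinAt_of_eq ((hp w hw).mul hγi) (fun t => ?_) ?_
        · simp [← mul_assoc]
        · have hD (x : Fin 2 → Vec n) (s : Fin 1 → ℝ) :
              value (flowDerivation y (p * X (Sum.inl (0, i)))) x s =
                value (flowDerivation y p) x s * x 0 i + value p x s * y i := by
            rw [Derivation.leibniz]
            simp [flowDerivation, mkDerivation_X]
            ring
          simp only [hD, mul_add, ← mul_assoc, Matrix.cons_val_zero]
          rw [intervalIntegral.integral_add ((hc w hw _ t).mul_const _)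
            ((hc w hw _ t).mul_const _)]
          simp
          ring
      · obtain rfl : j = 1 := by omega
        have hD (x : Fin 2 → Vec n) (s : Fin 1 → ℝ) :
            value (flowDerivation y (p * X (Sum.inl (1, i)))) x s =
              x 1 i * value (flowDerivation y p) x s := by
          rw [Derivation.leibniz]
          simp [flowDerivation, mkDerivation_X]
        -- A factor from `x₂` is a function of `t + θ` and joins the weight.
        convert hp (fun s => w s * γ s i) (by fun_prop) using 1
        · funext t
          congr 1
          funext θ
          simp
          ring
        · simp only [hD]
          simp [mul_assoc, mul_comm]
    · obtain rfl : v = 0 := Subsingleton.elim _ _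
      have hD (x : Fin 2 → Vec n) (s : Fin 1 → ℝ) :
          value (flowDerivation y (p * X (Sum.inr 0))) x s =
            s 0 * value (flowDerivation y p) x s - value p x s := by
        rw [Derivation.leibniz]
        simp [flowDerivation, mkDerivation_X]
        ring
      -- Write `θ = (t + θ) - t`: the first term joins the weight, the second leaves the integral.
      have hw' : Continuous fun s : ℝ => s * w s := by fun_prop
      refine hasDerivWithinAt_of_eq ((hp _ hw').sub ((hasDerivWithinAt_id t S).mul (hp w hw)))
        (fun t => ?_) ?_
      · simp only [Pi.sub_apply, Pi.mul_apply, id]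
        rw [← intervalIntegral.integral_const_mul,
          ← intervalIntegral.integral_sub (hc _ hw' p t) ((hc w hw p t).const_mul t)]
        congr 1
        funext θ
        simp
        ring
      · have h1 (θ : ℝ) : w (t + θ) * value (flowDerivation y (p * X (Sum.inr 0)))
              ![γ t, γ (t + θ)] ![θ] =
            (t + θ) * w (t + θ) * value (flowDerivation y p) ![γ t, γ (t + θ)] ![θ] -
            t * (w (t + θ) * value (flowDerivation y p) ![γ t, γ (t + θ)] ![θ]) -
            w (t + θ) * value p ![γ t, γ (t + θ)] ![θ] := by
          rw [hD]
          simp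
          ring
        simp only [h1]
        rw [intervalIntegral.integral_sub ((hc _ hw' _ t).sub ((hc w hw _ t).const_mul t))
          (hc w hw _ t), intervalIntegral.integral_sub (hc _ hw' _ t)
          ((hc w hw _ t).const_mul t), intervalIntegral.integral_const_mul]
        simp
        ring

/-- The integral of `F` over `[-τ, 0]²`. -/
noncomputable def doubleIntegral (τ : ℝ) (F : ℝ → ℝ → ℝ) : ℝ :=
  ∫ ω in (-τ)..0, ∫ θ in (-τ)..0, F θ ω

/-- The integral of the sum of the partial derivatives of a primitive over `[-τ, 0]²`, in terms
of the values `F` of the primitive on the boundary. -/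
noncomputable def boundaryIntegral (τ : ℝ) (F : ℝ → ℝ → ℝ) : ℝ :=
  (∫ ω in (-τ)..0, (F 0 ω - F (-τ) ω)) + ∫ θ in (-τ)..0, (F θ 0 - F θ (-τ))

lemma doubleIntegral_lin {F G : ℝ → ℝ → ℝ} (hF : Continuous fun z : ℝ × ℝ => F z.1 z.2)
    (hG : Continuous fun z : ℝ × ℝ => G z.1 z.2) (a b : ℝ) :
    doubleIntegral τ (fun θ ω => a * F θ ω + b * G θ ω) =
      a * doubleIntegral τ F + b * doubleIntegral τ G := by
  have hi {F : ℝ → ℝ → ℝ} (hF : Continuous fun z : ℝ × ℝ => F z.1 z.2) (ω : ℝ) :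
      IntervalIntegrable (fun θ => F θ ω) MeasureTheory.volume (-τ) 0 :=
    Continuous.intervalIntegrable
      (hF.comp (Continuous.prodMk continuous_id continuous_const)) _ _
  have ho {F : ℝ → ℝ → ℝ} (hF : Continuous fun z : ℝ × ℝ => F z.1 z.2) :
      IntervalIntegrable (fun ω => ∫ θ in (-τ)..0, F θ ω) MeasureTheory.volume (-τ) 0 :=
    Continuous.intervalIntegrable
      (intervalIntegral.continuous_parametric_intervalIntegral_of_continuous'
        (f := fun ω θ => F θ ω)
        (hF.comp continuous_swap) _ _) _ _
  simp only [doubleIntegral, ← intervalIntegral.integral_const_mul]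
  rw [← intervalIntegral.integral_add]
  · congr 1
    funext ω
    rw [← intervalIntegral.integral_add ((hi hF ω).const_mul a) ((hi hG ω).const_mul b)]
  · simpa only [intervalIntegral.integral_const_mul] using (ho hF).const_mul a
  · simpa only [intervalIntegral.integral_const_mul] using (ho hG).const_mul b

lemma boundaryIntegral_lin {F G : ℝ → ℝ → ℝ} (hF : Continuous fun z : ℝ × ℝ => F z.1 z.2)
    (hG : Continuous fun z : ℝ × ℝ => G z.1 z.2) (a b : ℝ) :
    boundaryIntegral τ (fun θ ω => a * F θ ω + b * G θ ω) =
      a * boundaryIntegral τ F + b * boundaryIntegral τ G := by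
  have h1 {F : ℝ → ℝ → ℝ} (hF : Continuous fun z : ℝ × ℝ => F z.1 z.2) (ω : ℝ) :
      Continuous fun θ => F θ ω := hF.comp (Continuous.prodMk continuous_id continuous_const)
  have h2 {F : ℝ → ℝ → ℝ} (hF : Continuous fun z : ℝ × ℝ => F z.1 z.2) (θ : ℝ) :
      Continuous fun ω => F θ ω := hF.comp (Continuous.prodMk continuous_const continuous_id)
  have e (a b A B C D : ℝ) : a * A + b * B - (a * C + b * D) = a * (A - C) + b * (B - D) := by
    ring
  simp only [boundaryIntegral, e]
  rw [intervalIntegral.integral_add, intervalIntegral.integral_add]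
  · simp only [intervalIntegral.integral_const_mul]
    ring
  all_goals apply Continuous.intervalIntegrable
  · exact (((h1 hF _).sub (h1 hF _)).const_mul a)
  · exact (((h1 hG _).sub (h1 hG _)).const_mul b)
  · exact (((h2 hF _).sub (h2 hF _)).const_mul a)
  · exact (((h2 hG _).sub (h2 hG _)).const_mul b)

/-- The derivation `-(∂/∂θ + ∂/∂ω)`. -/
noncomputable def shiftDerivation (n : ℕ) : Derivation ℝ (VPoly n 2 2) (VPoly n 2 2) :=
  -(pderiv (Sum.inr 0) + pderiv (Sum.inr 1))

/-- A weighted kernel along the curve `γ`. -/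
noncomputable def kernelAlong (γ : ℝ → Vec n) (p : VPoly n 2 2) (w₁ w₂ : ℝ → ℝ) (t θ ω : ℝ) : ℝ :=
  w₁ (t + θ) * w₂ (t + ω) * value p ![γ (t + θ), γ (t + ω)] ![θ, ω]

/-- The same induction with one weight per integration variable. Both vector arguments are now
delayed, so no derivative of `γ` occurs. -/
lemma hasDerivAt_doubleIntegral_value {γ : ℝ → Vec n} (hγ : Continuous γ) (t : ℝ)
    (p : VPoly n 2 2) : ∀ w₁ w₂ : ℝ → ℝ, Continuous w₁ → Continuous w₂ → HasDerivAt
      (fun t => doubleIntegral τ (kernelAlong γ p w₁ w₂ t))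
      (boundaryIntegral τ (kernelAlong γ p w₁ w₂ t)
        + doubleIntegral τ (kernelAlong γ (shiftDerivation n p) w₁ w₂ t)) t := by
  have hc (w₁ w₂ : ℝ → ℝ) (h₁ : Continuous w₁) (h₂ : Continuous w₂) (p : VPoly n 2 2)
      (t : ℝ) : Continuous fun z : ℝ × ℝ => kernelAlong γ p w₁ w₂ t z.1 z.2 := by
    unfold kernelAlong
    fun_prop
  have hlin (v : Fin 2) (p : VPoly n 2 2) :
      shiftDerivation n (p * X (Sum.inr v)) = X (Sum.inr v) * shiftDerivation n p - p := by
    rw [Derivation.leibniz]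
    fin_cases v <;> simp [shiftDerivation, pderiv_X] <;> ring
  -- The common step for both scalar factors, again `θ = (t + θ) - t`; `u₁`, `u₂` are the weights
  -- after absorbing `t + θ` or `t + ω`.
  have hscal {w₁ w₂ u₁ u₂ : ℝ → ℝ} (h₁ : Continuous w₁) (h₂ : Continuous w₂)
      (k₁ : Continuous u₁) (k₂ : Continuous u₂) (v : Fin 2)
      (hv : ∀ (p : VPoly n 2 2) (t θ ω : ℝ), kernelAlong γ (X (Sum.inr v) * p) w₁ w₂ t θ ω =
        1 * kernelAlong γ p u₁ u₂ t θ ω + (-t) * kernelAlong γ p w₁ w₂ t θ ω) (p : VPoly n 2 2)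
      (hw : HasDerivAt (fun t => doubleIntegral τ (kernelAlong γ p w₁ w₂ t))
      (boundaryIntegral τ (kernelAlong γ p w₁ w₂ t)
        + doubleIntegral τ (kernelAlong γ (shiftDerivation n p) w₁ w₂ t)) t)
      (hu : HasDerivAt (fun t => doubleIntegral τ (kernelAlong γ p u₁ u₂ t))
      (boundaryIntegral τ (kernelAlong γ p u₁ u₂ t)
        + doubleIntegral τ (kernelAlong γ (shiftDerivation n p) u₁ u₂ t)) t) :
      HasDerivAt (fun t => doubleIntegral τ (kernelAlong γ (p * X (Sum.inr v)) w₁ w₂ t))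
      (boundaryIntegral τ (kernelAlong γ (p * X (Sum.inr v)) w₁ w₂ t)
        + doubleIntegral τ (kernelAlong γ (shiftDerivation n (p * X (Sum.inr v))) w₁ w₂ t)) t := by
    have e1 (t : ℝ) : kernelAlong γ (p * X (Sum.inr v)) w₁ w₂ t = fun θ ω =>
        1 * kernelAlong γ p u₁ u₂ t θ ω + (-t) * kernelAlong γ p w₁ w₂ t θ ω := by
      funext θ ω
      rw [mul_comm p, hv]
    have e2 : kernelAlong γ (shiftDerivation n (p * X (Sum.inr v))) w₁ w₂ t = fun θ ω =>
        1 * kernelAlong γ (X (Sum.inr v) * shiftDerivation n p) w₁ w₂ t θ ω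
          + (-1) * kernelAlong γ p w₁ w₂ t θ ω := by
      funext θ ω
      rw [hlin]
      simp [kernelAlong]
      ring
    have e3 : kernelAlong γ (X (Sum.inr v) * shiftDerivation n p) w₁ w₂ t = fun θ ω =>
        1 * kernelAlong γ (shiftDerivation n p) u₁ u₂ t θ ω
          + (-t) * kernelAlong γ (shiftDerivation n p) w₁ w₂ t θ ω :=
      funext fun θ => funext fun ω => hv _ _ _ _
    rw [e2, doubleIntegral_lin (hc _ _ h₁ h₂ _ _) (hc _ _ h₁ h₂ _ _), e3,
      doubleIntegral_lin (hc _ _ k₁ k₂ _ _) (hc _ _ h₁ h₂ _ _)]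
    simp only [e1, doubleIntegral_lin (hc _ _ k₁ k₂ _ _) (hc _ _ h₁ h₂ _ _),
      boundaryIntegral_lin (hc _ _ k₁ k₂ _ _) (hc _ _ h₁ h₂ _ _)]
    refine ((hu.const_mul 1).add ((hasDerivAt_id t).neg.mul hw)).congr_deriv ?_
    simp
    ring
  induction p using MvPolynomial.induction_on with
  | C a =>
    intro w₁ w₂ h₁ h₂
    -- For a constant kernel the double integral is a product of two single ones.
    have key := ((hasDerivAt_integral_shift (τ := τ) h₁ t).mul
      (hasDerivAt_integral_shift (τ := τ) h₂ t)).mul_const a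
    rw [← hasDerivWithinAt_univ] at key ⊢
    refine hasDerivWithinAt_of_eq key (fun t => ?_) ?_
    · simp [doubleIntegral, kernelAlong]
    · have e1 (ω : ℝ) : w₁ t * w₂ (t + ω) * a - w₁ (t - τ) * w₂ (t + ω) * a =
          (w₁ t - w₁ (t - τ)) * a * w₂ (t + ω) := by ring
      have e2 (θ : ℝ) : w₁ (t + θ) * w₂ t * a - w₁ (t + θ) * w₂ (t - τ) * a =
          (w₂ t - w₂ (t - τ)) * a * w₁ (t + θ) := by ring
      have hD : shiftDerivation n (C a) = 0 := by simp [shiftDerivation]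
      simp only [doubleIntegral, boundaryIntegral, kernelAlong, hD, value_C, value_zero, add_zero,
        ← sub_eq_add_neg, e1, e2, intervalIntegral.integral_const_mul, mul_zero,
        intervalIntegral.integral_zero]
      ring
  | add p q hp hq =>
    intro w₁ w₂ h₁ h₂
    have e (p q : VPoly n 2 2) (t : ℝ) : kernelAlong γ (p + q) w₁ w₂ t = fun θ ω =>
        1 * kernelAlong γ p w₁ w₂ t θ ω + 1 * kernelAlong γ q w₁ w₂ t θ ω := by
      funext θ ω
      simp [kernelAlong, mul_add]
    simp only [map_add, e, doubleIntegral_lin (hc _ _ h₁ h₂ _ _) (hc _ _ h₁ h₂ _ _),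
      boundaryIntegral_lin (hc _ _ h₁ h₂ _ _) (hc _ _ h₁ h₂ _ _)]
    refine (((hp _ _ h₁ h₂).const_mul 1).add ((hq _ _ h₁ h₂).const_mul 1)).congr_deriv ?_
    ring
  | mul_X p v hp =>
    intro w₁ w₂ h₁ h₂
    rcases v with ⟨j, i⟩ | v
    · have hD : shiftDerivation n (p * X (Sum.inl (j, i))) =
          shiftDerivation n p * X (Sum.inl (j, i)) := by
        rw [Derivation.leibniz]
        simp [shiftDerivation, pderiv_X, mul_comm]
      rw [hD]
      by_cases hj : j = 0
      · subst hj
        have e (p : VPoly n 2 2) (t : ℝ) : kernelAlong γ (p * X (Sum.inl (0, i))) w₁ w₂ t =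
            kernelAlong γ p (fun s => w₁ s * γ s i) w₂ t := by
          funext θ ω
          simp [kernelAlong]
          ring
        simp only [e]
        exact hp _ _ (by fun_prop) h₂
      · obtain rfl : j = 1 := by omega
        have e (p : VPoly n 2 2) (t : ℝ) : kernelAlong γ (p * X (Sum.inl (1, i))) w₁ w₂ t =
            kernelAlong γ p w₁ (fun s => w₂ s * γ s i) t := by
          funext θ ω
          simp [kernelAlong]
          ring
        simp only [e]
        exact hp _ _ h₁ (by fun_prop)
    · by_cases hj : v = 0
      · subst hj
        have k : Continuous fun s : ℝ => s * w₁ s := by fun_prop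
        refine hscal h₁ h₂ k h₂ 0 (fun p t θ ω => ?_) p (hp _ _ h₁ h₂) (hp _ _ k h₂)
        simp [kernelAlong]
        ring
      · obtain rfl : v = 1 := by omega
        have k : Continuous fun s : ℝ => s * w₂ s := by fun_prop
        refine hscal h₁ h₂ h₁ k 1 (fun p t θ ω => ?_) p (hp _ _ h₁ h₂) (hp _ _ h₁ k)
        simp [kernelAlong]
        ring

end Leibniz

/-! ### Positivity from sums of squares and semidefinite kernels. -/

section Positivity

variable {n : ℕ} {τ : ℝ}

lemma Xi₁.le_integral (hτ : 0 < τ) {d : ℕ} {g : VPoly n 2 1} (hg : g ∈ Xi₁ n τ d) :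
    ∃ α : ℝ, 0 < α ∧ ∀ (x : Vec n) (u : ℝ → Vec n), Continuous u →
      α * ‖x‖ ^ 2 ≤ ∫ θ in (-τ)..0, value g ![x, u θ] ![θ] := by
  obtain ⟨-, t, α, -, hα, hs, ht⟩ := hg
  -- The factor `τ` is the length of the interval of integration.
  refine ⟨τ * α, by positivity, fun x u hu => ?_⟩
  have hct : Continuous fun θ : ℝ => value t ![x] ![θ] := by fun_prop
  have hi : ∫ θ in (-τ)..0, (value t ![x] ![θ] + α * ‖x‖ ^ 2) = τ * α * ‖x‖ ^ 2 := by
    rw [intervalIntegral.integral_add (hct.intervalIntegrable _ _) (by simp), ht]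
    simp
    ring
  rw [← hi]
  refine intervalIntegral.integral_mono_on (by linarith)
    (by apply Continuous.intervalIntegrable; fun_prop)
    (by apply Continuous.intervalIntegrable; fun_prop) fun θ _ => ?_
  have h := value_nonneg_of_isSumSq hs ![x, u θ] ![θ]
  have e : (fun j : Fin 1 => (![x, u θ] : Fin 2 → Vec n) j.castSucc) = ![x] := by
    funext j; fin_cases j; rfl
  simp only [value_sub, value_addVec, value_mul, value_C, value_normSqFst, e,
    Matrix.cons_val_zero] at h
  linarith

lemma Xi₃.le_integral (hτ : 0 < τ) {d : ℕ} {g : VPoly n 3 1} (hg : g ∈ Xi₃ n τ d) :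
    ∃ α : ℝ, 0 < α ∧ ∀ (x y : Vec n) (u : ℝ → Vec n), Continuous u →
      α * ‖x‖ ^ 2 ≤ ∫ θ in (-τ)..0, value g ![x, y, u θ] ![θ] := by
  obtain ⟨-, t, α, -, hα, hs, ht⟩ := hg
  refine ⟨τ * α, by positivity, fun x y u hu => ?_⟩
  have hct : Continuous fun θ : ℝ => value t ![x, y] ![θ] := by fun_prop
  have hi : ∫ θ in (-τ)..0, (value t ![x, y] ![θ] + α * ‖x‖ ^ 2) = τ * α * ‖x‖ ^ 2 := by
    rw [intervalIntegral.integral_add (hct.intervalIntegrable _ _) (by simp), ht]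
    simp
    ring
  rw [← hi]
  refine intervalIntegral.integral_mono_on (by linarith)
    (by apply Continuous.intervalIntegrable; fun_prop)
    (by apply Continuous.intervalIntegrable; fun_prop) fun θ _ => ?_
  have h := value_nonneg_of_isSumSq hs ![x, y, u θ] ![θ]
  have e : (fun j : Fin 2 => (![x, y, u θ] : Fin 3 → Vec n) j.castSucc) = ![x, y] := by
    funext j; fin_cases j <;> rfl
  simp only [value_sub, value_addVec, value_mul, value_C, value_normSqFst, e,
    Matrix.cons_val_zero] at h
  linarith

/-- By bilinearity the double integral is the quadratic form of `Q` at the vector `∫ z`. -/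
lemma doubleIntegral_quadratic_nonneg {ι : Type*} [Fintype ι] {Q : Matrix ι ι ℝ}
    (hQ : Q.PosSemidef) {z : ℝ → ι → ℝ} (hz : Continuous z) :
    0 ≤ doubleIntegral τ (fun θ ω => z θ ⬝ᵥ (Q *ᵥ z ω)) := by
  set v : ι → ℝ := fun i => ∫ θ in (-τ)..0, z θ i with hv
  have hi (i : ι) : Continuous fun θ => z θ i := by fun_prop
  have e1 (y : ι → ℝ) : ∫ θ in (-τ)..0, z θ ⬝ᵥ y = v ⬝ᵥ y := by
    simp only [dotProduct, hv]
    rw [intervalIntegral.integral_finsetSum fun i _ => Continuous.intervalIntegrable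
      (show Continuous fun θ => z θ i * y i by fun_prop) _ _]
    simp only [intervalIntegral.integral_mul_const]
  have e2 : doubleIntegral τ (fun θ ω => z θ ⬝ᵥ (Q *ᵥ z ω)) = v ⬝ᵥ (Q *ᵥ v) := by
    simp only [doubleIntegral, e1]
    simp only [Matrix.dotProduct_mulVec v Q, dotProduct_comm (v ᵥ* Q)]
    rw [e1]
  rw [e2]
  simpa using hQ.dotProduct_mulVec_nonneg v

lemma Xi₂.doubleIntegral_nonneg {d : ℕ} {h : VPoly n 2 2} (hh : h ∈ Xi₂ n d) {u : ℝ → Vec n}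
    (hu : Continuous u) :
    0 ≤ doubleIntegral τ (fun θ ω => value h ![u θ, u ω] ![θ, ω]) := by
  obtain ⟨-, R, ⟨Q, hQ, hR⟩, hp⟩ := hh
  have e (θ ω : ℝ) : value h ![u θ, u ω] ![θ, ω] =
      (blockMonomials _ (d / 2) θ *ᵥ monomials (d / 2) (u θ)) ⬝ᵥ
        (Q *ᵥ (blockMonomials _ (d / 2) ω *ᵥ monomials (d / 2) (u ω))) := by
    rw [hp, hR, ← Matrix.mulVec_mulVec, ← Matrix.mulVec_mulVec, Matrix.dotProduct_mulVec,
      Matrix.vecMul_transpose]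
  simp only [e]
  refine doubleIntegral_quadratic_nonneg hQ ?_
  refine Continuous.matrix_mulVec (continuous_matrix fun a b => ?_) ?_
  · simp only [blockMonomials, Matrix.of_apply]
    split_ifs <;> fun_prop
  · refine continuous_pi fun i => ?_
    unfold monomials
    fun_prop

end Positivity

/-! ### The functional: continuity, lower bound, derivative along solutions. -/

section Lyapunov

variable {n : ℕ} {τ : ℝ}

lemma continuous_IciExtend (x : Traj n τ) : Continuous (IciExtend (x : Ici (-τ) → Vec n)) :=
  x.continuous.comp ((continuous_const.max continuous_id).subtype_mk _)

lemma lyapunov_eq (hτ : 0 < τ) (g : VPoly n 2 1) (h : VPoly n 2 2) (φ : State n τ)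
    {u : ℝ → Vec n} (hu : ∀ θ : Icc (-τ) (0 : ℝ), φ θ = u θ) :
    lyapunov hτ g h φ = (∫ θ in (-τ)..0, value g ![u 0, u θ] ![θ]) +
      doubleIntegral τ (fun θ ω => value h ![u θ, u ω] ![θ, ω]) := by
  have hle : -τ ≤ 0 := by linarith
  have e {θ : ℝ} (hθ : θ ∈ uIcc (-τ) 0) : IccExtend (neg_nonpos.mpr hτ.le) φ θ = u θ := by
    rw [uIcc_of_le hle] at hθ
    rw [IccExtend_of_mem _ _ hθ, hu]
  simp only [lyapunov, doubleIntegral]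
  congr 1
  · refine intervalIntegral.integral_congr fun θ hθ => ?_
    simp only [e hθ, hu, now]
  · refine intervalIntegral.integral_congr fun ω hω => ?_
    refine intervalIntegral.integral_congr fun θ hθ => ?_
    simp only [e hθ, e hω]

lemma continuous_lyapunov (hτ : 0 < τ) (g : VPoly n 2 1) (h : VPoly n 2 2) :
    Continuous (lyapunov hτ g h) := by
  have he : Continuous fun z : State n τ × ℝ => IccExtend (neg_nonpos.mpr hτ.le) z.1 z.2 := by
    have : Continuous fun z : State n τ × ℝ => z.1 (projIcc (-τ) 0 (neg_nonpos.mpr hτ.le) z.2) := by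
      fun_prop
    exact this
  have e0 : Continuous fun φ : State n τ => φ (now hτ) := by fun_prop
  unfold lyapunov
  refine Continuous.add ?_ ?_
  · refine intervalIntegral.continuous_parametric_intervalIntegral_of_continuous'
      (f := fun (φ : State n τ) θ => value g ![φ (now hτ),
        IccExtend (neg_nonpos.mpr hτ.le) φ θ] ![θ]) ?_ _ _
    refine continuous_value g (Continuous.matrixVecCons (e0.comp continuous_fst)
      (Continuous.matrixVecCons he continuous_const)) (by fun_prop)
  · refine intervalIntegral.continuous_parametric_intervalIntegral_of_continuous'
      (f := fun (φ : State n τ) ω => ∫ θ in (-τ)..0,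
        value h ![IccExtend (neg_nonpos.mpr hτ.le) φ θ, IccExtend (neg_nonpos.mpr hτ.le) φ ω]
          ![θ, ω]) ?_ _ _
    refine intervalIntegral.continuous_parametric_intervalIntegral_of_continuous'
      (f := fun (z : State n τ × ℝ) θ =>
        value h ![IccExtend (neg_nonpos.mpr hτ.le) z.1 θ, IccExtend (neg_nonpos.mpr hτ.le) z.1 z.2]
          ![θ, z.2]) ?_ _ _
    refine continuous_value h (Continuous.matrixVecCons
      (he.comp ((continuous_fst.comp continuous_fst).prodMk continuous_snd))
      (Continuous.matrixVecCons (he.comp continuous_fst) continuous_const)) (by fun_prop)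

lemma exists_mul_normSq_le_lyapunov (hτ : 0 < τ) {d : ℕ} {g : VPoly n 2 1} {h : VPoly n 2 2}
    (hg : g ∈ Xi₁ n τ d) (hh : h ∈ Xi₂ n d) :
    ∃ α : ℝ, 0 < α ∧ ∀ φ : State n τ, α * ‖φ (now hτ)‖ ^ 2 ≤ lyapunov hτ g h φ := by
  obtain ⟨α, hα, hle⟩ := Xi₁.le_integral hτ hg
  refine ⟨α, hα, fun φ => ?_⟩
  have hc : Continuous (IccExtend (neg_nonpos.mpr hτ.le) φ) := φ.continuous.Icc_extend'
  have h1 := hle (φ (now hτ)) _ hc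
  have h2 := Xi₂.doubleIntegral_nonneg (τ := τ) hh hc
  exact h1.trans (le_add_of_nonneg_right h2)

lemma exists_lyapunov_deriv_le (hτ : 0 < τ) (f : Vec n → Vec n → Vec n)
    {d : ℕ} {g : VPoly n 2 1} {h hHat : VPoly n 2 2} {gHat : VPoly n 3 1}
    (hhHat : hHat ∈ Xi₂ n d)
    (hgHat : -gHat ∈ Xi₃ n τ d)
    (gHat_eq : ∀ (φ : State n τ) (θ : Icc (-τ) (0 : ℝ)),
      value gHat ![φ (now hτ), φ (past hτ), φ θ] ![(θ : ℝ)] =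
        value g ![φ (now hτ), φ (now hτ)] ![0] - value g ![φ (now hτ), φ (past hτ)] ![-τ]
        + τ * ∑ i : Fin n, value (dVec 0 i g) ![φ (now hτ), φ θ] ![(θ : ℝ)]
            * f (φ (now hτ)) (φ (past hτ)) i
        - τ * value (dScal 0 g) ![φ (now hτ), φ θ] ![(θ : ℝ)]
        + τ * value h ![φ (now hτ), φ θ] ![0, (θ : ℝ)]
        - τ * value h ![φ (past hτ), φ θ] ![-τ, (θ : ℝ)]
        + τ * value h ![φ θ, φ (now hτ)] ![(θ : ℝ), 0]
        - τ * value h ![φ θ, φ (past hτ)] ![(θ : ℝ), -τ])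
    (hHat_eq : ∀ (φ : State n τ) (θ ω : Icc (-τ) (0 : ℝ)),
      value hHat ![φ θ, φ ω] ![(θ : ℝ), (ω : ℝ)] =
        value (dScal 0 h) ![φ θ, φ ω] ![(θ : ℝ), (ω : ℝ)]
        + value (dScal 1 h) ![φ θ, φ ω] ![(θ : ℝ), (ω : ℝ)]) :
    ∃ α : ℝ, 0 < α ∧ ∀ x : Traj n τ, ∀ t : ℝ,
      HasDerivWithinAt (IciExtend x) (singleDelay hτ f (stateAt x t)) (Ici 0) t →
      ∃ D : ℝ, D ≤ -(α * ‖IciExtend x t‖ ^ 2) ∧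
        HasDerivWithinAt (fun t => lyapunov hτ g h (stateAt x t)) D (Ici 0) t := by
  obtain ⟨α, hα, hle⟩ := Xi₃.le_integral hτ hgHat
  -- The identity for `gHat` carries a factor `τ` relative to the derivative of `V`.
  refine ⟨α / τ, by positivity, fun x t hx => ?_⟩
  have hτ' : -τ ≤ 0 := by linarith
  set γ : ℝ → Vec n := IciExtend x with hγ
  have hc : Continuous γ := continuous_IciExtend x
  have hct : Continuous fun θ => γ (t + θ) := by fun_prop
  set y := singleDelay hτ f (stateAt x t) with hy
  have hyf : y = f (γ t) (γ (t - τ)) := by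
    simp [hy, singleDelay, stateAt, now, past, hγ, sub_eq_add_neg]
  have hk (p : VPoly n 2 2) (t : ℝ) : kernelAlong γ p (fun _ => 1) (fun _ => 1) t =
      fun θ ω => value p ![γ (t + θ), γ (t + ω)] ![θ, ω] := by
    funext θ ω
    simp [kernelAlong]
  have hone : Continuous fun _ : ℝ => (1 : ℝ) := continuous_const
  have dg := hasDerivWithinAt_integral_value (τ := τ) hc hx g _ hone
  have dh := (hasDerivAt_doubleIntegral_value (τ := τ) hc t h _ _ hone hone).hasDerivWithinAt
    (s := Ici 0)
  refine ⟨_, ?_, hasDerivWithinAt_of_eq (dg.add dh) (fun t => ?_) rfl⟩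
  · simp only [hk, one_mul, value_flowDerivation]
    have hsd : doubleIntegral τ (fun θ ω => value (shiftDerivation n h)
        ![γ (t + θ), γ (t + ω)] ![θ, ω]) =
        -doubleIntegral τ (fun θ ω => value hHat ![γ (t + θ), γ (t + ω)] ![θ, ω]) := by
      simp only [doubleIntegral, ← intervalIntegral.integral_neg]
      refine intervalIntegral.integral_congr fun ω hω => ?_
      refine intervalIntegral.integral_congr fun θ hθ => ?_
      rw [uIcc_of_le hτ'] at hθ hω
      have := hHat_eq (stateAt x t) ⟨θ, hθ⟩ ⟨ω, hω⟩
      simp only [stateAt, ContinuousMap.coe_mk, ← hγ, dScal] at this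
      simp only [this, shiftDerivation, Derivation.neg_apply, Derivation.add_apply, value_neg,
        value_add]
    have hpos := Xi₂.doubleIntegral_nonneg (τ := τ) hhHat hct
    have hG := hle (γ t) (γ (t - τ)) _ hct
    simp only [value_neg, intervalIntegral.integral_neg] at hG
    -- In the integrated identity the terms without `θ` acquire a factor `τ`, matching the explicit
    -- `τ` of the others.
    have hint : ∫ θ in (-τ)..0, value gHat ![γ t, γ (t - τ), γ (t + θ)] ![θ] =
        τ * (value g ![γ t, γ t] ![0] - value g ![γ t, γ (t - τ)] ![-τ]
          + (∫ θ in (-τ)..0, (∑ i, value (dVec 0 i g) ![γ t, γ (t + θ)] ![θ] * y i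
            - value (dScal 0 g) ![γ t, γ (t + θ)] ![θ]))
          + boundaryIntegral τ (fun θ ω => value h ![γ (t + θ), γ (t + ω)] ![θ, ω])) := by
      rw [boundaryIntegral]
      have e : ∀ θ ∈ uIcc (-τ) 0, value gHat ![γ t, γ (t - τ), γ (t + θ)] ![θ] =
          (value g ![γ t, γ t] ![0] - value g ![γ t, γ (t - τ)] ![-τ])
          + τ * ((∑ i, value (dVec 0 i g) ![γ t, γ (t + θ)] ![θ] * y i
            - value (dScal 0 g) ![γ t, γ (t + θ)] ![θ])
          + ((value h ![γ (t + 0), γ (t + θ)] ![0, θ] - value h ![γ (t + -τ), γ (t + θ)] ![-τ, θ])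
          + (value h ![γ (t + θ), γ (t + 0)] ![θ, 0]
            - value h ![γ (t + θ), γ (t + -τ)] ![θ, -τ]))) := by
        intro θ hθ
        rw [uIcc_of_le hτ'] at hθ
        have := gHat_eq (stateAt x t) ⟨θ, hθ⟩
        simp only [stateAt, ContinuousMap.coe_mk, ← hγ, now, past, add_zero,
          ← sub_eq_add_neg, ← hyf] at this
        rw [this]
        simp only [add_zero, ← sub_eq_add_neg]
        ring
      rw [intervalIntegral.integral_congr e, intervalIntegral.integral_add (by simp),
        intervalIntegral.integral_const_mul, intervalIntegral.integral_add,
        intervalIntegral.integral_add]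
      · simp
        ring
      all_goals
        apply Continuous.intervalIntegrable
        fun_prop
    rw [hsd]
    rw [hint] at hG
    have : α / τ * ‖γ t‖ ^ 2 = α * ‖γ t‖ ^ 2 / τ := by ring
    rw [this]
    have h3 : α * ‖γ t‖ ^ 2 / τ ≤ -(value g ![γ t, γ t] ![0] - value g ![γ t, γ (t - τ)] ![-τ]
          + (∫ θ in (-τ)..0, (∑ i, value (dVec 0 i g) ![γ t, γ (t + θ)] ![θ] * y i
            - value (dScal 0 g) ![γ t, γ (t + θ)] ![θ]))
          + boundaryIntegral τ (fun θ ω => value h ![γ (t + θ), γ (t + ω)] ![θ, ω])) := by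
      rw [div_le_iff₀ hτ]
      linarith
    linarith
  · rw [lyapunov_eq hτ g h (stateAt x t) (u := fun θ => γ (t + θ)) fun θ => rfl]
    simp [hk]

end Lyapunov

/-! ### Barbalat-type decay arguments for curves in a normed space. -/

section Decay

lemma sub_le_mul_of_hasDerivWithinAt {v : ℝ → ℝ} {a b K : ℝ} (ha : 0 ≤ a) (hab : a ≤ b)
    (hv : ∀ s ∈ Icc a b, ∃ D ≤ K, HasDerivWithinAt v D (Ici 0) s) :
    v b - v a ≤ K * (b - a) := by
  have hd : ∀ s ∈ Ioo a b, ∃ D ≤ K, HasDerivAt v D s := fun s hs => by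
    obtain ⟨D, hD, h⟩ := hv s (Ioo_subset_Icc_self hs)
    exact ⟨D, hD, h.hasDerivAt (Ici_mem_nhds (ha.trans_lt hs.1))⟩
  refine (convex_Icc a b).image_sub_le_mul_sub_of_deriv_le (fun s hs => ?_) (fun s hs => ?_)
    (fun s hs => ?_) a (left_mem_Icc.2 hab) b (right_mem_Icc.2 hab) hab
  · obtain ⟨D, -, h⟩ := hv s hs
    exact (h.mono (Icc_subset_Ici_self.trans (Ici_subset_Ici.2 ha))).continuousWithinAt
  · rw [interior_Icc] at hs
    obtain ⟨D, -, h⟩ := hd s hs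
    exact h.differentiableAt.differentiableWithinAt
  · rw [interior_Icc] at hs
    obtain ⟨D, hD, h⟩ := hd s hs
    rwa [h.deriv]

variable {E : Type*} [NormedAddCommGroup E] {γ : ℝ → E} {v : ℝ → ℝ} {α L : ℝ}

/-- During a time `ε / (2 * L)` the Lipschitz curve moves by at most `ε / 2`, so its norm stays at
least `ε / 2` and `v` decreases at rate at least `α * (ε / 2) ^ 2`. -/
lemma decay_of_le_norm (hα : 0 < α) (hL : 0 < L)
    (hγ : ∀ s t : ℝ, 0 ≤ s → s ≤ t → ‖γ t - γ s‖ ≤ L * (t - s))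
    (hv : ∀ t : ℝ, 0 ≤ t → ∃ D ≤ -(α * ‖γ t‖ ^ 2), HasDerivWithinAt v D (Ici 0) t)
    {t ε : ℝ} (ht : 0 ≤ t) (hε : 0 < ε) (hle : ε ≤ ‖γ t‖) :
    v (t + ε / (2 * L)) ≤ v t - α * (ε / 2) ^ 2 * (ε / (2 * L)) := by
  have hh : 0 < ε / (2 * L) := by positivity
  have key := sub_le_mul_of_hasDerivWithinAt (v := v) (a := t) (b := t + ε / (2 * L))
    (K := -(α * (ε / 2) ^ 2)) ht (by linarith) fun s hs => by
      obtain ⟨D, hD, h⟩ := hv s (ht.trans hs.1)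
      refine ⟨D, hD.trans ?_, h⟩
      have h1 : ‖γ s - γ t‖ ≤ ε / 2 := by
        refine (hγ t s ht hs.1).trans ?_
        calc L * (s - t) ≤ L * (ε / (2 * L)) := by gcongr; linarith [hs.2]
          _ = ε / 2 := by field_simp
      have h2 : ε / 2 ≤ ‖γ s‖ := by
        have := norm_sub_norm_le (γ t) (γ s)
        rw [norm_sub_rev] at this
        linarith
      gcongr
  linarith

lemma antitoneOn_of_decay (hα : 0 < α)
    (hv : ∀ t : ℝ, 0 ≤ t → ∃ D ≤ -(α * ‖γ t‖ ^ 2), HasDerivWithinAt v D (Ici 0) t) :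
    AntitoneOn v (Ici 0) := by
  intro s hs t _ hst
  have := sub_le_mul_of_hasDerivWithinAt (v := v) (K := 0) hs hst fun r hr => by
    obtain ⟨D, hD, h⟩ := hv r (le_trans hs hr.1)
    exact ⟨D, hD.trans (by simp; positivity), h⟩
  linarith

/-- The monotone function `v` converges, so it eventually lacks the room for the drop that a value
of norm at least `ε` would force. -/
lemma tendsto_zero_of_decay (hα : 0 < α) (hL : 0 < L)
    (hγ : ∀ s t : ℝ, 0 ≤ s → s ≤ t → ‖γ t - γ s‖ ≤ L * (t - s))
    (hv : ∀ t : ℝ, 0 ≤ t → ∃ D ≤ -(α * ‖γ t‖ ^ 2), HasDerivWithinAt v D (Ici 0) t)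
    (hpos : ∀ t : ℝ, 0 ≤ t → 0 ≤ v t) :
    Tendsto γ atTop (𝓝 0) := by
  have hanti := antitoneOn_of_decay hα hv
  -- Clamping time at `0` makes `v` antitone on the whole line.
  have hmono : Antitone fun t => v (max t 0) := fun s t hst =>
    hanti (mem_Ici.2 (le_max_right _ _)) (mem_Ici.2 (le_max_right _ _)) (max_le_max_right 0 hst)
  have hbdd : BddBelow (range fun t => v (max t 0)) :=
    ⟨0, by rintro _ ⟨t, rfl⟩; exact hpos _ (le_max_right _ _)⟩
  have hlim := tendsto_atTop_ciInf hmono hbdd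
  rw [NormedAddGroup.tendsto_nhds_zero]
  intro ε hε
  have hκ : 0 < α * (ε / 2) ^ 2 * (ε / (2 * L)) := by positivity
  filter_upwards [hlim.eventually (gt_mem_nhds (lt_add_of_pos_right _ hκ)), eventually_ge_atTop 0]
    with t ht ht0
  by_contra! hcon
  have h1 := decay_of_le_norm hα hL hγ hv ht0 hε hcon
  have h2 := ciInf_le hbdd (t + ε / (2 * L))
  have h3 : 0 ≤ t + ε / (2 * L) := by positivity
  simp only [max_eq_left ht0, max_eq_left h3] at ht h2
  linarith

/-- Over `[T, T + 1]` with `T` large, `γ` changes by nearly `c`, yet both endpoint values are nearly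
zero. -/
lemma eq_zero_of_tendsto_deriv [NormedSpace ℝ E] {γ' : ℝ → E} {c : E}
    (hγ : ∀ t : ℝ, 0 ≤ t → HasDerivWithinAt γ (γ' t) (Ici 0) t) (h0 : Tendsto γ atTop (𝓝 0))
    (hc : Tendsto γ' atTop (𝓝 c)) : c = 0 := by
  rw [← norm_le_zero_iff]
  refine le_of_forall_pos_le_add fun ε hε => ?_
  rw [NormedAddGroup.tendsto_nhds_zero] at h0
  have hc' := (tendsto_iff_norm_sub_tendsto_zero.1 hc).eventually
    (gt_mem_nhds (show 0 < ε / 3 by positivity))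
  obtain ⟨T, hT⟩ := eventually_atTop.1 ((h0 (ε / 3) (by positivity)).and
    (hc'.and (eventually_ge_atTop 0)))
  have hT0 : 0 ≤ T := (hT T le_rfl).2.2
  have key := norm_image_sub_le_of_norm_deriv_le_segment' (f := fun s => γ s - s • c)
    (f' := fun s => γ' s - c) (a := T) (b := T + 1) (C := ε / 3)
    (fun s hs => by
      have := ((hγ s (hT0.trans hs.1)).mono
        (Icc_subset_Ici_self.trans (Ici_subset_Ici.2 hT0) : Icc T (T + 1) ⊆ Ici 0)).sub
          ((hasDerivWithinAt_id s _).smul_const c)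
      rw [one_smul] at this
      exact this)
    (fun s hs => (hT s hs.1).2.1.le) (T + 1) (by simp)
  have e : c = γ (T + 1) - γ T - ((γ (T + 1) - (T + 1) • c) - (γ T - T • c)) := by module
  have h1 := (hT T le_rfl).1
  have h2 := (hT (T + 1) (by linarith)).1
  have h3 : ‖c‖ ≤ ‖γ (T + 1)‖ + ‖γ T‖ + ‖(γ (T + 1) - (T + 1) • c) - (γ T - T • c)‖ := by
    conv_lhs => rw [e]
    exact (norm_sub_le _ _).trans (by gcongr; exact norm_sub_le _ _)
  simp only [add_sub_cancel_left, mul_one] at key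
  linarith

end Decay

/-! ### Global asymptotic stability from a functional that may be nonzero at the origin. -/

section Stability

variable {n : ℕ} {τ : ℝ}

lemma isSolution_solutionMap {F : State n τ → Vec n} (hF : HasSolutionMap F) (φ : State n τ) :
    IsSolution F φ (solutionMap hF φ) := (hF φ).choose_spec.1

lemma IsSolution.stateAt_zero {F : State n τ → Vec n} {φ : State n τ} {x : Traj n τ}
    (hx : IsSolution F φ x) : stateAt x 0 = φ := by
  ext1 θ
  have h : -τ ≤ (θ : ℝ) := θ.2.1
  simp only [stateAt, ContinuousMap.coe_mk, zero_add]
  rw [IciExtend_of_mem _ h]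
  exact hx.1 θ

lemma IsSolution.IciExtend_eq {F : State n τ → Vec n} {φ : State n τ} {x : Traj n τ}
    (hx : IsSolution F φ x) (θ : Icc (-τ) (0 : ℝ)) : IciExtend x θ = φ θ := by
  rw [IciExtend_of_mem _ θ.2.1]
  exact hx.1 θ

lemma tendsto_stateAt {x : Traj n τ} (hx : Tendsto (IciExtend x) atTop (𝓝 0)) :
    Tendsto (stateAt x) atTop (𝓝 0) := by
  rw [NormedAddGroup.tendsto_nhds_zero] at hx ⊢
  intro ε hε
  obtain ⟨T, hT⟩ := eventually_atTop.1 (hx (ε / 2) (by positivity))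
  filter_upwards [eventually_ge_atTop (T + τ)] with t ht
  refine lt_of_le_of_lt ((ContinuousMap.norm_le _ (by positivity : 0 ≤ ε / 2)).2 fun θ => ?_)
    (half_lt_self hε)
  exact (hT _ (by linarith [θ.2.1])).le

/-- Where a right derivative exists, the upper limit is a limit. -/
lemma upperLieDeriv_eq {F : State n τ → Vec n} (hF : HasSolutionMap F) {V : State n τ → ℝ}
    {φ : State n τ} {D : ℝ}
    (hD : HasDerivWithinAt (fun t => V (stateAt (solutionMap hF φ) t)) D (Ici 0) 0) :
    upperLieDeriv hF V φ = (D : EReal) := by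
  rw [hasDerivWithinAt_iff_tendsto_slope, Ici_sdiff_left] at hD
  refine Tendsto.limsup_eq ((continuous_coe_real_ereal.tendsto D).comp (hD.congr fun s => ?_))
  simp only [slope, sub_zero, vsub_eq_sub, smul_eq_mul, flowMap,
    (isSolution_solutionMap hF φ).stateAt_zero]
  ring

/-- A continuous functional that bounds the square of the present value from above and decreases
along the solutions of a single-delay system at a rate of at least that square makes the system
globally asymptotically stable. The functional need not vanish at the origin. -/
theorem isGloballyAsymptoticallyStable_of_functional (hτ : 0 < τ) {f : Vec n → Vec n → Vec n}
    (hf : Continuous fun p : Vec n × Vec n => f p.1 p.2)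
    (hF : HasSolutionMap (singleDelay hτ f)) {V : State n τ → ℝ} (hV : Continuous V) {α : ℝ}
    (hα : 0 < α) (hlow : ∀ φ : State n τ, α * ‖φ (now hτ)‖ ^ 2 ≤ V φ)
    (hdec : ∀ (φ : State n τ) (t : ℝ), 0 ≤ t →
      ∃ D ≤ -(α * ‖IciExtend (solutionMap hF φ) t‖ ^ 2),
        HasDerivWithinAt (fun t => V (stateAt (solutionMap hF φ) t)) D (Ici 0) t) :
    IsGloballyAsymptoticallyStable hF := by
  set γ : State n τ → ℝ → Vec n := fun φ => IciExtend (solutionMap hF φ) with hγ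
  set v : State n τ → ℝ → ℝ := fun φ t => V (stateAt (solutionMap hF φ) t) with hv
  have hsol (φ : State n τ) := isSolution_solutionMap hF φ
  have hv0 (φ : State n τ) : v φ 0 = V φ := by simp only [hv, (hsol φ).stateAt_zero]
  have hvle (φ : State n τ) (t : ℝ) (ht : 0 ≤ t) : v φ t ≤ V φ := by
    rw [← hv0 φ]
    exact antitoneOn_of_decay hα (hdec φ) self_mem_Ici ht ht
  have hγv (φ : State n τ) (t : ℝ) : α * ‖γ φ t‖ ^ 2 ≤ v φ t := by
    have h := hlow (stateAt (solutionMap hF φ) t)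
    rwa [show stateAt (solutionMap hF φ) t (now hτ) = γ φ t by simp [stateAt, now, hγ]] at h
  have hderiv (φ : State n τ) (t : ℝ) (ht : 0 ≤ t) :
      HasDerivWithinAt (γ φ) (f (γ φ t) (γ φ (t - τ))) (Ici 0) t := by
    simpa [singleDelay, stateAt, now, past, sub_eq_add_neg] using (hsol φ).2 t ht
  have hpast (φ : State n τ) (t : ℝ) (ht : -τ ≤ t) (ht0 : t ≤ 0) : ‖γ φ t‖ ≤ ‖φ‖ := by
    rw [show γ φ t = φ ⟨t, ht, ht0⟩ from (hsol φ).IciExtend_eq ⟨t, ht, ht0⟩]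
    exact φ.norm_coe_le_norm _
  have hbound (M : ℝ) : ∃ B, ∀ φ : State n τ, ‖φ‖ ≤ M → V φ ≤ M → ∀ t, -τ ≤ t → ‖γ φ t‖ ≤ B := by
    refine ⟨max M (√(M / α)), fun φ h1 h2 t ht => ?_⟩
    rcases le_total t 0 with ht0 | ht0
    · exact le_max_of_le_left ((hpast φ t ht ht0).trans h1)
    · refine le_max_of_le_right (Real.le_sqrt_of_sq_le ?_)
      rw [le_div_iff₀ hα]
      linarith [hγv φ t, hvle φ t ht0]
  -- The constant depends on `M` only, because `f` is bounded on a product of balls containing all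
  -- present and delayed values; stability needs this uniformity.
  have hlip (M : ℝ) : ∃ L, 0 < L ∧ ∀ φ : State n τ, ‖φ‖ ≤ M → V φ ≤ M →
      ∀ s t : ℝ, 0 ≤ s → s ≤ t → ‖γ φ t - γ φ s‖ ≤ L * (t - s) := by
    obtain ⟨B, hB⟩ := hbound M
    obtain ⟨K, hK⟩ := ((isCompact_closedBall (0 : Vec n) B).prod
      (isCompact_closedBall (0 : Vec n) B)).exists_bound_of_continuousOn hf.continuousOn
    refine ⟨max K 1, by positivity, fun φ h1 h2 s t hs hst => ?_⟩
    refine norm_image_sub_le_of_norm_deriv_le_segment' (fun r hr => (hderiv φ r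
      (hs.trans hr.1)).mono (Icc_subset_Ici_self.trans (Ici_subset_Ici.2 hs)))
      (fun r hr => le_max_of_le_left (hK (γ φ r, γ φ (r - τ)) ⟨?_, ?_⟩)) t (right_mem_Icc.2 hst)
    · simpa using hB φ h1 h2 r (by linarith [hr.1])
    · simpa using hB φ h1 h2 (r - τ) (by linarith [hr.1])
  have hconv (φ : State n τ) : Tendsto (γ φ) atTop (𝓝 0) := by
    obtain ⟨L, hL, h⟩ := hlip (max ‖φ‖ (V φ))
    exact tendsto_zero_of_decay hα hL (h φ (le_max_left _ _) (le_max_right _ _)) (hdec φ)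
      fun t _ => le_trans (by positivity) (hγv φ t)
  -- `V` decreases along the solution to its limit `V 0`.
  have hlimV (φ : State n τ) (t : ℝ) (ht : 0 ≤ t) : V 0 ≤ v φ t := by
    refine le_of_tendsto ((hV.tendsto 0).comp (tendsto_stateAt (hconv φ))) ?_
    filter_upwards [eventually_ge_atTop t] with s hs
    exact antitoneOn_of_decay hα (hdec φ) ht (ht.trans hs) hs
  have hcoe (φ : State n τ) (t : Ici (-τ)) : solutionMap hF φ t = γ φ t :=
    (IciExtend_of_mem _ t.2).symm
  refine ⟨⟨?_, fun φ _ => ?_, fun ε hε => ?_⟩, fun φ _ => ?_⟩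
  · refine eq_zero_of_tendsto_deriv (hderiv 0) (hconv 0) ?_
    have h1 : Tendsto (fun t => γ 0 (t - τ)) atTop (𝓝 0) :=
      (hconv 0).comp (tendsto_atTop_add_const_right _ (-τ) tendsto_id)
    exact (hf.tendsto (0, 0)).comp ((hconv 0).prodMk_nhds h1)
  · obtain ⟨B, hB⟩ := hbound (max ‖φ‖ (V φ))
    refine ⟨B, fun t => ?_⟩
    rw [hcoe]
    exact hB φ (le_max_left _ _) (le_max_right _ _) t t.2
  · obtain ⟨L, hL, h⟩ := hlip (max 1 (V 0 + 1))
    have hκ : 0 < min 1 (α * (ε / 2) ^ 2 * (ε / (2 * L))) := by positivity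
    obtain ⟨δ, hδ, hδV⟩ := Metric.eventually_nhds_iff.1
      ((hV.tendsto 0).eventually (gt_mem_nhds (lt_add_of_pos_right (V 0) hκ)))
    -- `δ` keeps `V φ` near `V 0`, `1` selects the uniform Lipschitz constant, and `ε` handles times
    -- in `[-τ, 0]`.
    refine ⟨min δ (min 1 ε), by positivity, fun φ hφ t => ?_⟩
    obtain ⟨h1, h2, h3⟩ : ‖φ‖ < δ ∧ ‖φ‖ < 1 ∧ ‖φ‖ < ε := by simpa using hφ
    have h4 : V φ < V 0 + min 1 (α * (ε / 2) ^ 2 * (ε / (2 * L))) := hδV (by simpa using h1)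
    rw [hcoe]
    rcases le_total (t : ℝ) 0 with ht | ht
    · exact (hpast φ t t.2 ht).trans_lt h3
    · by_contra! hcon
      have h5 := decay_of_le_norm hα hL (h φ (h2.le.trans (le_max_left _ _))
        (le_max_of_le_right (h4.le.trans (by gcongr; exact min_le_left _ _)))) (hdec φ) ht hε hcon
      have h6 := hlimV φ (t + ε / (2 * L)) (by positivity)
      have h7 := hvle φ t ht
      have h8 := min_le_right 1 (α * (ε / 2) ^ 2 * (ε / (2 * L)))
      simp only [hv] at h6 h7
      linarith
  · simp only [hcoe]
    exact tendsto_comp_val_Ici_atTop.2 (hconv φ)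

end Stability

end TimeDelay

open TimeDelay
theorem mainTheorem10 (n : ℕ) (τ : ℝ) (hτ : 0 < τ)
    (f : Vec n → Vec n → Vec n) (hf : Continuous fun p : Vec n × Vec n => f p.1 p.2)
    (hF : HasSolutionMap (singleDelay hτ f))
    (d : ℕ) (g : VPoly n 2 1) (h hHat : VPoly n 2 2) (gHat : VPoly n 3 1)
    (hg : g ∈ Xi₁ n τ d) (hh : h ∈ Xi₂ n d) (hhHat : hHat ∈ Xi₂ n d)
    (hgHat : -gHat ∈ Xi₃ n τ d)
    (gHat_eq : ∀ (φ : State n τ) (θ : Icc (-τ) (0 : ℝ)),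
      value gHat ![φ (now hτ), φ (past hτ), φ θ] ![(θ : ℝ)] =
        value g ![φ (now hτ), φ (now hτ)] ![0] - value g ![φ (now hτ), φ (past hτ)] ![-τ]
        + τ * ∑ i : Fin n, value (dVec 0 i g) ![φ (now hτ), φ θ] ![(θ : ℝ)]
            * f (φ (now hτ)) (φ (past hτ)) i
        - τ * value (dScal 0 g) ![φ (now hτ), φ θ] ![(θ : ℝ)]
        + τ * value h ![φ (now hτ), φ θ] ![0, (θ : ℝ)]
        - τ * value h ![φ (past hτ), φ θ] ![-τ, (θ : ℝ)]
        + τ * value h ![φ θ, φ (now hτ)] ![(θ : ℝ), 0]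
        - τ * value h ![φ θ, φ (past hτ)] ![(θ : ℝ), -τ])
    (hHat_eq : ∀ (φ : State n τ) (θ ω : Icc (-τ) (0 : ℝ)),
      value hHat ![φ θ, φ ω] ![(θ : ℝ), (ω : ℝ)] =
        value (dScal 0 h) ![φ θ, φ ω] ![(θ : ℝ), (ω : ℝ)]
        + value (dScal 1 h) ![φ θ, φ ω] ![(θ : ℝ), (ω : ℝ)]) :
    IsGloballyAsymptoticallyStable hF ∧
    ∃ α : ℝ, 0 < α ∧ ∀ φ : State n τ,
      α * ‖φ (now hτ)‖ ^ 2 ≤ lyapunov hτ g h φ ∧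
      upperLieDeriv hF (lyapunov hτ g h) φ ≤ ((-(α * ‖φ (now hτ)‖ ^ 2) : ℝ) : EReal) := by
  obtain ⟨α₁, hα₁, hlow⟩ := exists_mul_normSq_le_lyapunov hτ hg hh
  obtain ⟨α₂, hα₂, hdec⟩ := exists_lyapunov_deriv_le hτ f hhHat hgHat gHat_eq hHat_eq
  have hα : 0 < min α₁ α₂ := lt_min hα₁ hα₂
  have hlow' (φ : State n τ) : min α₁ α₂ * ‖φ (now hτ)‖ ^ 2 ≤ lyapunov hτ g h φ :=
    le_trans (by gcongr; exact min_le_left _ _) (hlow φ)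
  have hdec' (φ : State n τ) (t : ℝ) (ht : 0 ≤ t) :
      ∃ D ≤ -(min α₁ α₂ * ‖IciExtend (solutionMap hF φ) t‖ ^ 2),
        HasDerivWithinAt (fun t => lyapunov hτ g h (stateAt (solutionMap hF φ) t)) D (Ici 0) t := by
    obtain ⟨D, hD, h⟩ := hdec (solutionMap hF φ) t ((isSolution_solutionMap hF φ).2 t ht)
    exact ⟨D, hD.trans (by gcongr; exact min_le_right _ _), h⟩
  refine ⟨isGloballyAsymptoticallyStable_of_functional hτ hf hF (continuous_lyapunov hτ g h) hα
    hlow' hdec', min α₁ α₂, hα, fun φ => ⟨hlow' φ, ?_⟩⟩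
  obtain ⟨D, hD, h⟩ := hdec' φ 0 le_rfl
  rw [upperLieDeriv_eq hF h, EReal.coe_le_coe_iff]
  have h0 : IciExtend (solutionMap hF φ) 0 = φ (now hτ) :=
    (isSolution_solutionMap hF φ).IciExtend_eq (now hτ)
  rwa [h0] at hD
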